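/- Let $\mathbb{C}^+=\{z\in\mathbb{C}:\operatorname{Im} z>0\}$. A Herglotz--Pick (HP) function is an analytic function $F:\mathbb{C}^+\to\overline{\mathbb{C}^+}=\{z:\operatorname{Im}z\ge 0\}$. It has a unique representation $$F(z)=b+az+\int_{\mathbb{R}}\Big(\frac{1}{u-z}-\frac{u}{u^2+1}\Big)\,\mu(du),\qquad a\ge 0,\ b\in\mathbb{R},$$ where $\mu$ is a Borel measure on $\mathbb{R}$ with $\int (u^2+1)^{-1}\mu(du)<\infty$; $\mu$ is called the spectral measure of $F$. Identify $F$ with the pair $(\mu,F(i))$ and give the set of HP functions the corresponding topology, namely the product of the vague topology (tested against continuous compactly supported functions) for $\mu$ and the usual topology for $F(i)\in\mathbb{C}$. A random HP function is a random element of this space with its Borel $\sigma$-algebra, and convergence in distribution of random HP functions is weak convergence of their laws on this space. Write $F(x+i0)=\lim_{\eta\downarrow0}F(x+i\eta)$ when this limit exists in $\mathbb{C}$. **Theorem.** Let $F_n$ ($n\in\mathbb{N}$) and $F$ be random HP functions, with random spectral measures $\mu_n$ and $\mu$, such that $F_n$ converges in distribution to $F$. Let $[a,b]\subset\mathbb{R}$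 be an interval in which, almost surely, each of the measures $\mu_n$ and $\mu$ is a simple point process, i.e. its restriction to $[a,b]$ is a sum of unit point masses at finitely many distinct points. Let $x\in(a,b)$ be such that $\mathbb{E}[\mu(\{x\})]=0$. Then $F(x+i0)$ exists almost surely, the probability that $F_n(x+i0)$ exists tends to $1$ as $n\to\infty$, and $$F_n(x+i0)\ \xrightarrow{\ \mathcal{D}\ }\ F(x+i0)$$ in distribution as complex random variables, where $F_n(x+i0)$ is given the value $0$ on the event, of vanishing probability, that the limit does not exist. -/

import Mathlib

open MeasureTheory Filter Topology Set
open scoped UpperHalfPlane CompactlySupported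

/-- A Herglotz-Pick (HP) function: an analytic function from the open upper half plane `ℍ` into
the closed upper half plane. -/
structure HPFunction where
  toFun : ℍ → ℂ
  analytic' : DifferentiableOn ℂ (fun z : ℂ => toFun (UpperHalfPlane.ofComplex z))
    {z : ℂ | 0 < z.im}
  im_nonneg' : ∀ z : ℍ, 0 ≤ (toFun z).im

namespace HPFunction

instance : CoeFun HPFunction (fun _ => ℍ → ℂ) := ⟨HPFunction.toFun⟩

/-- `μ` is a measure representing the HP function `F`: `∫ (u² + 1)⁻¹ μ(du) < ∞` and
`F(z) = b + a z + ∫ (1 / (u - z) - u / (u² + 1)) μ(du)` on `ℍ`, with `a ≥ 0` and `b` real. -/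
def IsSpectralMeasure (F : HPFunction) (μ : Measure ℝ) : Prop :=
  Integrable (fun u : ℝ => (u ^ 2 + 1)⁻¹) μ ∧
    ∃ a b : ℝ, 0 ≤ a ∧ ∀ z : ℍ,
      F z = (b : ℂ) + (a : ℂ) * (z : ℂ) +
        ∫ u : ℝ, (1 / ((u : ℂ) - (z : ℂ)) - (u : ℂ) / ((u : ℂ) ^ 2 + 1)) ∂μ

open Classical in
/-- The spectral measure of an HP function. By the Herglotz representation theorem every HP
function has exactly one, so the second branch is never taken. -/
noncomputable def spectralMeasure (F : HPFunction) : Measure ℝ :=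
  if h : ∃ μ : Measure ℝ, F.IsSpectralMeasure μ then h.choose else 0

/-- An HP function is identified with the pair `(μ, F(i))` of its spectral measure and its value
at `i`. The topology on HP functions is that of this pair: the vague topology for `μ` (convergence
of `∫ f dμ` for every continuous compactly supported `f`), times the usual topology of `ℂ`. -/
noncomputable instance : TopologicalSpace HPFunction :=
  TopologicalSpace.induced
    (fun F : HPFunction =>
      ((fun f : C_c(ℝ, ℝ) => ∫ u : ℝ, f u ∂F.spectralMeasure), F UpperHalfPlane.I))
    (inferInstance : TopologicalSpace ((C_c(ℝ, ℝ) → ℝ) × ℂ))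

noncomputable instance : MeasurableSpace HPFunction := borel HPFunction

instance : BorelSpace HPFunction := ⟨rfl⟩

/-- `w = F(x + i0)`, that is, `F(x + iη) → w` as `η ↓ 0`. -/
def HasBoundaryValue (F : HPFunction) (x : ℝ) (w : ℂ) : Prop :=
  Tendsto (fun η : ℝ => F (UpperHalfPlane.ofComplex ((x : ℂ) + (η : ℂ) * Complex.I)))
    (𝓝[>] 0) (𝓝 w)

open Classical in
/-- The boundary value `F(x + i0)`, with the value `0` where the limit does not exist in `ℂ`. -/
noncomputable def boundaryValue (F : HPFunction) (x : ℝ) : ℂ :=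
  if h : ∃ w : ℂ, F.HasBoundaryValue x w then h.choose else 0

end HPFunction

/-- In the interval `[a, b]` the measure `μ` is a simple point configuration: a sum of unit point
masses at finitely many distinct points (finitely many because spectral measures are finite on
compact intervals). -/
def IsSimplePointMeasureOn (μ : Measure ℝ) (a b : ℝ) : Prop :=
  ∃ S : Finset ℝ, μ.restrict (Icc a b) = ∑ p ∈ S, Measure.dirac p

/-- **Schwarz integral formula** on the unit disc. -/
theorem DiffContOnCl.circleAverage_herglotzRieszKernel_mul_re {g : ℂ → ℂ}
    (hg : DiffContOnCl ℂ g (Metric.ball 0 1)) {w : ℂ} (hw : w ∈ Metric.ball (0 : ℂ) 1) :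
    Real.circleAverage (fun ζ => (ζ + w) / (ζ - w) * ((g ζ).re : ℂ)) 0 1
      = g w - Complex.I * ((g 0).im : ℂ) := by
  have hw1 : ‖w‖ < 1 := by simpa using hw
  have hcl : ContinuousOn g (Metric.closedBall 0 1) := by
    simpa [closure_ball (0 : ℂ) one_ne_zero] using hg.2
  have hsph : Metric.sphere (0 : ℂ) |1| ⊆ Metric.closedBall 0 1 := by
    simpa using Metric.sphere_subset_closedBall
  have hgc : ContinuousOn g (Metric.sphere 0 |1|) := hcl.mono hsph
  have hne : ∀ ζ ∈ Metric.sphere (0 : ℂ) |1|, ζ - w ≠ 0 := by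
    intro ζ hζ h
    have : ζ = w := sub_eq_zero.1 h
    simp at hζ
    rw [this] at hζ; linarith
  have hne' : ∀ ζ ∈ Metric.closedBall (0 : ℂ) 1, 1 - starRingEnd ℂ w * ζ ≠ 0 := by
    intro ζ hζ h
    have h1 : starRingEnd ℂ w * ζ = 1 := (sub_eq_zero.1 h).symm
    have h2 : ‖w‖ * ‖ζ‖ = 1 := by rw [← RCLike.norm_conj w, ← norm_mul, h1, norm_one]
    have h3 : ‖ζ‖ ≤ 1 := by simpa using hζ
    nlinarith [norm_nonneg ζ, norm_nonneg w]
  -- Cauchy's formula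
  have hA : Real.circleAverage (fun ζ => ζ / (ζ - w) * g ζ) 0 1 = g w := by
    have := DiffContOnCl.circleAverage_smul_div (c := 0) (R := 1) (f := g) (w := w)
      (by simpa using hg) (by simpa using hw)
    simpa using this
  have hB : Real.circleAverage g 0 1 = g 0 := DiffContOnCl.circleAverage (by simpa using hg)
  -- the mean value property of the conjugate kernel
  have hC : Real.circleAverage
      (fun ζ => (1 + starRingEnd ℂ w * ζ) / (1 - starRingEnd ℂ w * ζ) * g ζ) 0 1 = g 0 := by
    have hd : DiffContOnCl ℂ
        (fun ζ => (1 + starRingEnd ℂ w * ζ) / (1 - starRingEnd ℂ w * ζ) * g ζ)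
        (Metric.ball 0 1) := by
      constructor
      · refine DifferentiableOn.mul (DifferentiableOn.div (by fun_prop) (by fun_prop) ?_) hg.1
        exact fun ζ hζ => hne' ζ (Metric.ball_subset_closedBall hζ)
      · rw [closure_ball (0 : ℂ) one_ne_zero]
        exact (ContinuousOn.div (by fun_prop) (by fun_prop) hne').mul hcl
    have := DiffContOnCl.circleAverage (c := (0 : ℂ)) (R := 1) (by simpa using hd)
    simpa using this
  have hCc : ContinuousOn
      (fun ζ => (1 + starRingEnd ℂ w * ζ) / (1 - starRingEnd ℂ w * ζ) * g ζ)
      (Metric.sphere 0 |1|) :=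
    (ContinuousOn.div (by fun_prop) (by fun_prop) (fun ζ hζ => hne' ζ (hsph hζ))).mul hgc
  have hC' := Complex.conjCLE.toContinuousLinearMap.circleAverage_comp_comm
    (hCc.circleIntegrable' (c := 0) (R := 1))
  rw [hC] at hC'
  have hI1 : CircleIntegrable (fun ζ => ζ / (ζ - w) * g ζ) 0 1 :=
    ((ContinuousOn.div (by fun_prop) (by fun_prop) hne).mul hgc).circleIntegrable'
  have hI2 : CircleIntegrable (fun ζ => (1 / 2 : ℂ) * g ζ) 0 1 :=
    ContinuousOn.circleIntegrable' (by fun_prop)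
  have hI3 : CircleIntegrable (fun ζ => (1 / 2 : ℂ) • (Complex.conjCLE.toContinuousLinearMap ∘
      fun ζ => (1 + starRingEnd ℂ w * ζ) / (1 - starRingEnd ℂ w * ζ) * g ζ) ζ) 0 1 := by
    refine ContinuousOn.circleIntegrable' ?_
    refine ContinuousOn.const_smul (g := Complex.conjCLE.toContinuousLinearMap ∘
      fun ζ => (1 + starRingEnd ℂ w * ζ) / (1 - starRingEnd ℂ w * ζ) * g ζ) ?_ (1 / 2 : ℂ)
    exact Complex.conjCLE.continuous.comp_continuousOn hCc
  have key : Set.EqOn (fun ζ => (ζ + w) / (ζ - w) * ((g ζ).re : ℂ))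
      (fun ζ => (((fun ζ => ζ / (ζ - w) * g ζ) - fun ζ => (1 / 2 : ℂ) * g ζ) ζ) +
        (1 / 2 : ℂ) • (Complex.conjCLE.toContinuousLinearMap ∘
      fun ζ => (1 + starRingEnd ℂ w * ζ) / (1 - starRingEnd ℂ w * ζ) * g ζ) ζ)
      (Metric.sphere 0 |1|) := by
    intro ζ hζ
    have h1 : ζ * starRingEnd ℂ ζ = 1 := by
      rw [Complex.mul_conj, Complex.normSq_eq_norm_sq]
      have : ‖ζ‖ = 1 := by simpa using hζ
      simp [this]
    have h0 : ζ ≠ 0 := left_ne_zero_of_mul_eq_one h1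
    have h2 : starRingEnd ℂ ζ = ζ⁻¹ := eq_inv_of_mul_eq_one_right h1
    have h3 := hne ζ hζ
    have h4 : (1 + w * ζ⁻¹) / (1 - w * ζ⁻¹) = (ζ + w) / (ζ - w) := by
      have : 1 - w * ζ⁻¹ ≠ 0 := by
        intro h; apply h3; field_simp at h; simpa using h
      field_simp
    simp only [Pi.sub_apply, Function.comp_apply, ContinuousLinearEquiv.coe_coe, Complex.conjCLE_apply, map_mul,
      map_div₀, map_add, map_sub, map_one, Complex.conj_conj, h2, h4, smul_eq_mul]
    rw [Complex.re_eq_add_conj]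
    field_simp
    ring
  rw [Real.circleAverage_congr_sphere key, Real.circleAverage_fun_add (hI1.sub hI2) hI3,
    Real.circleAverage_sub hI1 hI2, hA]
  rw [show (fun ζ => (1 / 2 : ℂ) * g ζ) = fun ζ => (1 / 2 : ℂ) • g ζ from rfl,
    Real.circleAverage_fun_smul, Real.circleAverage_fun_smul, hB]
  rw [show Real.circleAverage (fun ζ => (Complex.conjCLE.toContinuousLinearMap ∘ fun ζ =>
    (1 + starRingEnd ℂ w * ζ) / (1 - starRingEnd ℂ w * ζ) * g ζ) ζ) 0 1 = _ from hC']
  simp only [ContinuousLinearEquiv.coe_coe, Complex.conjCLE_apply, smul_eq_mul]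
  apply Complex.ext <;> simp <;> ring

/-- The finite measure on the circle with continuous density `f` with respect to normalised arc
length. -/
noncomputable def circleDensityMeasure (f : ℂ → ℝ) : Measure (Metric.sphere (0 : ℂ) 1) :=
  (((volume.restrict (Ioc 0 (2 * Real.pi))).withDensity
    (fun θ => ENNReal.ofReal ((2 * Real.pi)⁻¹ * f (circleMap 0 1 θ))))).map
    (fun θ => (⟨circleMap 0 1 θ, circleMap_mem_sphere 0 zero_le_one θ⟩ : Metric.sphere (0 : ℂ) 1))

theorem integral_circleDensityMeasure {f : ℂ → ℝ} (hf : ContinuousOn f (Metric.sphere 0 1))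
    (h0 : ∀ ζ ∈ Metric.sphere (0 : ℂ) 1, 0 ≤ f ζ) (k : C(Metric.sphere (0 : ℂ) 1, ℂ)) (k' : ℂ → ℂ)
    (hk : ∀ ζ : Metric.sphere (0 : ℂ) 1, k ζ = k' ζ) :
    ∫ ζ, k ζ ∂(circleDensityMeasure f) =
      Real.circleAverage (fun ζ => k' ζ * (f ζ : ℂ)) 0 1 := by
  have hc : Continuous (fun θ : ℝ => f (circleMap 0 1 θ)) :=
    hf.comp_continuous (by fun_prop) (fun θ => by simp [circleMap])
  have h0' : ∀ θ : ℝ, 0 ≤ f (circleMap 0 1 θ) := fun θ => h0 _ (by simp [circleMap])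
  have hm : Continuous (fun θ : ℝ =>
      (⟨circleMap 0 1 θ, circleMap_mem_sphere 0 zero_le_one θ⟩ : Metric.sphere (0 : ℂ) 1)) := by
    fun_prop
  unfold circleDensityMeasure
  rw [integral_map hm.aemeasurable (by fun_prop),
    integral_withDensity_eq_integral_toReal_smul
      (hc.const_mul _).measurable.ennreal_ofReal (by simp)]
  rw [Real.circleAverage_def, intervalIntegral.integral_of_le (by positivity),
    ← integral_smul]
  congr 1
  ext θ
  rw [ENNReal.toReal_ofReal (mul_nonneg (by positivity) (h0' θ)), hk]
  simp [circleMap, Complex.real_smul]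
  ring

theorem isFiniteMeasure_circleDensityMeasure {f : ℂ → ℝ}
    (hf : ContinuousOn f (Metric.sphere 0 1)) :
    IsFiniteMeasure (circleDensityMeasure f) := by
  have hc : Continuous (fun θ : ℝ => f (circleMap 0 1 θ)) :=
    hf.comp_continuous (by fun_prop) (fun θ => by simp [circleMap])
  have : IsFiniteMeasure (((volume.restrict (Ioc 0 (2 * Real.pi))).withDensity
    (fun θ => ENNReal.ofReal ((2 * Real.pi)⁻¹ * f (circleMap 0 1 θ))))) := by
    apply isFiniteMeasure_withDensity_ofReal
    have : IntegrableOn (fun θ => (2 * Real.pi)⁻¹ * f (circleMap 0 1 θ)) (Ioc 0 (2 * Real.pi)) :=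
      (Continuous.integrableOn_Icc (hc.const_mul _)).mono_set Ioc_subset_Icc_self
    exact this.2
  unfold circleDensityMeasure
  infer_instance

/-- The Herglotz-Riesz kernel as a continuous function on the circle. -/
noncomputable def herglotzKernelCircle (w : ℂ) (hw : ‖w‖ < 1) : C(Metric.sphere (0 : ℂ) 1, ℂ) where
  toFun ζ := ((ζ : ℂ) + w) / ((ζ : ℂ) - w)
  continuous_toFun := by
    refine Continuous.div (by fun_prop) (by fun_prop) (fun ζ h => ?_)
    have h1 : (ζ : ℂ) = w := sub_eq_zero.1 h
    have h2 : ‖(ζ : ℂ)‖ = 1 := by simp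
    rw [h1] at h2; linarith

/-- **Herglotz representation theorem** on the unit disc. -/
theorem exists_measure_circle_herglotz {g : ℂ → ℂ}
    (hg : DifferentiableOn ℂ g (Metric.ball 0 1)) (hre : ∀ w ∈ Metric.ball (0 : ℂ) 1, 0 ≤ (g w).re) :
    ∃ σ : Measure (Metric.sphere (0 : ℂ) 1), IsFiniteMeasure σ ∧ ∀ w ∈ Metric.ball (0 : ℂ) 1,
      g w = Complex.I * ((g 0).im : ℂ) + ∫ ζ : Metric.sphere (0 : ℂ) 1, ((ζ : ℂ) + w) / ((ζ : ℂ) - w) ∂σ := by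
  set r : ℕ → ℝ := fun n => 1 - 1 / ((n : ℝ) + 2) with hr
  have hr0 : ∀ n, 0 < r n := by
    intro n
    have : 1 / ((n : ℝ) + 2) < 1 := by
      rw [div_lt_one (by positivity)]; linarith [(Nat.cast_nonneg n : (0 : ℝ) ≤ n)]
    simp only [hr]; linarith
  have hr1 : ∀ n, r n < 1 := by
    intro n
    have : 0 < 1 / ((n : ℝ) + 2) := by positivity
    simp only [hr]; linarith
  have hrt : Tendsto r atTop (𝓝 1) := by
    have : Tendsto (fun n : ℕ => 1 / ((n : ℝ) + 2)) atTop (𝓝 0) := by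
      have := tendsto_const_nhds (x := (1 : ℝ)).div_atTop
        (tendsto_atTop_add_const_right atTop (2 : ℝ) tendsto_natCast_atTop_atTop)
      simpa using this
    simpa [hr] using this.const_sub 1
  have hmaps : ∀ n, ∀ z ∈ Metric.closedBall (0 : ℂ) 1, (r n : ℂ) * z ∈ Metric.ball (0 : ℂ) 1 := by
    intro n z hz
    have hz' : ‖z‖ ≤ 1 := by simpa using hz
    simp only [mem_ball_zero_iff, norm_mul, Complex.norm_real, Real.norm_eq_abs,
      abs_of_pos (hr0 n)]
    nlinarith [hr0 n, hr1 n, norm_nonneg z]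
  have hdcl : ∀ n, DiffContOnCl ℂ (fun z => g (r n * z)) (Metric.ball 0 1) := by
    intro n
    have : DifferentiableOn ℂ (fun z => g (r n * z)) (Metric.closedBall 0 1) :=
      hg.comp (by fun_prop) (hmaps n)
    refine ⟨this.mono Metric.ball_subset_closedBall, ?_⟩
    rw [closure_ball (0 : ℂ) one_ne_zero]
    exact this.continuousOn
  have hfc : ∀ n, ContinuousOn (fun z => (g (r n * z)).re) (Metric.sphere 0 1) := by
    intro n
    have h := (hdcl n).2
    rw [closure_ball (0 : ℂ) one_ne_zero] at h
    exact Complex.continuous_re.comp_continuousOn (h.mono Metric.sphere_subset_closedBall)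
  have hf0 : ∀ n, ∀ ζ ∈ Metric.sphere (0 : ℂ) 1, 0 ≤ (g (r n * ζ)).re :=
    fun n ζ hζ => hre _ (hmaps n ζ (Metric.sphere_subset_closedBall hζ))
  let σ : ℕ → FiniteMeasure (Metric.sphere (0 : ℂ) 1) := fun n =>
    ⟨circleDensityMeasure (fun z => (g (r n * z)).re), isFiniteMeasure_circleDensityMeasure (hfc n)⟩
  have hσ : ∀ n (w : ℂ) (hw : ‖w‖ < 1), ∫ ζ, herglotzKernelCircle w hw ζ ∂(σ n : Measure (Metric.sphere (0 : ℂ) 1))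
      = g (r n * w) - Complex.I * ((g 0).im : ℂ) := by
    intro n w hw
    have h1 := integral_circleDensityMeasure (hfc n) (hf0 n) (herglotzKernelCircle w hw)
      (fun ζ => (ζ + w) / (ζ - w)) (fun ζ => rfl)
    have h2 := (hdcl n).circleAverage_herglotzRieszKernel_mul_re (w := w) (by simpa using hw)
    rw [h2] at h1
    simp only [mul_zero] at h1
    exact h1
  have hmass : ∀ n, ((σ n).mass : ℝ) = (g 0).re := by
    intro n
    have h := hσ n 0 (by simp)
    have h1 : ∀ ζ : Metric.sphere (0 : ℂ) 1, herglotzKernelCircle 0 (by simp) ζ = 1 := by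
      intro ζ; have h1 : (ζ : ℂ) ≠ 0 := Metric.ne_of_mem_sphere ζ.2 one_ne_zero
      simp [herglotzKernelCircle, h1]
    simp only [h1, integral_const, mul_zero] at h
    have h2 := congrArg Complex.re h
    simp at h2
    exact h2
  have hcomp := isCompact_setOfPred_finiteMeasure_eq_of_compactSpace (Metric.sphere (0 : ℂ) 1) (σ 0).mass
  have hmem : ∀ n, σ n ∈ {μ : FiniteMeasure (Metric.sphere (0 : ℂ) 1) | μ.mass = (σ 0).mass} := by
    intro n
    apply NNReal.coe_injective
    rw [hmass, hmass]
  obtain ⟨ν, -, hν⟩ := hcomp.ultrafilter_le_nhds ((Ultrafilter.of atTop).map σ)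
    (le_principal_iff.2 (by
      rw [Ultrafilter.mem_coe, Ultrafilter.mem_map]
      exact Filter.univ_mem' hmem))
  have hlim : Tendsto σ (Ultrafilter.of (atTop : Filter ℕ)) (𝓝 ν) := hν
  rw [FiniteMeasure.tendsto_iff_forall_integral_rclike_tendsto ℂ] at hlim
  refine ⟨ν, inferInstance, fun w hw => ?_⟩
  have hw' : ‖w‖ < 1 := by simpa using hw
  have h1 := hlim (BoundedContinuousFunction.mkOfCompact (herglotzKernelCircle w hw'))
  simp only [BoundedContinuousFunction.mkOfCompact_apply, hσ] at h1
  have h2 : Tendsto (fun n => g (r n * w) - Complex.I * ((g 0).im : ℂ)) (Ultrafilter.of (atTop : Filter ℕ))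
      (𝓝 (g w - Complex.I * ((g 0).im : ℂ))) := by
    refine Tendsto.sub_const ?_ _
    refine Tendsto.mono_left ?_ (Ultrafilter.of_le atTop)
    have hcont : ContinuousAt g w := (hg.differentiableAt (Metric.isOpen_ball.mem_nhds hw)).continuousAt
    refine hcont.tendsto.comp ?_
    have := ((Complex.continuous_ofReal.tendsto 1).comp hrt).mul_const w
    simpa using this
  have h3 := tendsto_nhds_unique h1 h2
  have h4 : ∫ ζ : Metric.sphere (0 : ℂ) 1, ((ζ : ℂ) + w) / ((ζ : ℂ) - w) ∂(ν : Measure (Metric.sphere (0 : ℂ) 1)) =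
    g w - Complex.I * ((g 0).im : ℂ) := h3
  rw [h4]; ring

/-- The Cayley transform from the unit disc to the upper half plane has positive imaginary part. -/
theorem im_cayley_pos {w : ℂ} (hw : ‖w‖ < 1) : 0 < (Complex.I * (1 + w) / (1 - w)).im := by
  have h1 : 1 - w ≠ 0 := by
    intro h
    have : w = 1 := (sub_eq_zero.1 h).symm
    simp [this] at hw
  have h2 : 0 < Complex.normSq (1 - w) := Complex.normSq_pos.2 h1
  have h3 : w.re ^ 2 + w.im ^ 2 < 1 := by
    have := Complex.sq_norm w
    rw [Complex.normSq_apply] at this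
    nlinarith [norm_nonneg w]
  have h4 : (Complex.I * (1 + w) / (1 - w)).im
      = (1 - (w.re ^ 2 + w.im ^ 2)) / Complex.normSq (1 - w) := by
    rw [Complex.div_im]
    simp
    ring
  rw [h4]
  exact div_pos (by linarith) h2

theorem norm_inv_cayley_lt_one {z : ℂ} (hz : 0 < z.im) :
    ‖(z - Complex.I) / (z + Complex.I)‖ < 1 := by
  have h1 : z + Complex.I ≠ 0 := by
    intro h
    have := congrArg Complex.im h
    simp at this; linarith
  rw [norm_div, div_lt_one (norm_pos_iff.2 h1)]
  apply lt_of_pow_lt_pow_left₀ 2 (norm_nonneg _)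
  rw [Complex.sq_norm, Complex.sq_norm, Complex.normSq_apply, Complex.normSq_apply]
  simp
  nlinarith

/-- The inverse of `u ↦ (u - i) / (u + i)`, as a map from the circle to the line. -/
noncomputable def circleToLine (ζ : Metric.sphere (0 : ℂ) 1) : ℝ :=
  -(ζ : ℂ).im / (1 - (ζ : ℂ).re)

theorem measurable_circleToLine : Measurable circleToLine := by
  unfold circleToLine
  fun_prop

theorem circleToLine_kernel {ζ : Metric.sphere (0 : ℂ) 1} (hζ : (ζ : ℂ) ≠ 1) {z : ℂ}
    (hz : 0 < z.im) :
    Complex.I * (((ζ : ℂ) + (z - Complex.I) / (z + Complex.I)) /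
        ((ζ : ℂ) - (z - Complex.I) / (z + Complex.I))) =
      (1 + (circleToLine ζ : ℂ) ^ 2) * (1 / ((circleToLine ζ : ℂ) - z) -
        (circleToLine ζ : ℂ) / ((circleToLine ζ : ℂ) ^ 2 + 1)) := by
  obtain ⟨ζ, hs⟩ := ζ
  have hn : ζ.re ^ 2 + ζ.im ^ 2 = 1 := by
    have h1 : ‖ζ‖ = 1 := by simpa using hs
    have := Complex.sq_norm ζ
    rw [Complex.normSq_apply, h1] at this
    linarith
  have hre : 1 - ζ.re ≠ 0 := by
    intro h
    apply hζ
    have h1 : ζ.re = 1 := by linarith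
    have h2 : ζ.im = 0 := by
      rw [h1] at hn
      have : ζ.im ^ 2 = 0 := by linarith
      simpa using this
    exact Complex.ext (by simpa using h1) (by simpa using h2)
  set u : ℝ := circleToLine ⟨ζ, hs⟩ with hu
  have hζu : ζ * ((u : ℂ) + Complex.I) = (u : ℂ) - Complex.I := by
    have h3 : u * (1 - ζ.re) = -ζ.im := by
      rw [hu, circleToLine]
      exact div_mul_cancel₀ _ hre
    apply Complex.ext
    · simp; linarith
    · simp
      have : (u * ζ.im + ζ.re + 1) * (1 - ζ.re) = 0 := by
        linear_combination ζ.im * h3 - hn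
      rcases mul_eq_zero.1 this with h | h
      · linarith
      · exact absurd h hre
  have huI : (u : ℂ) + Complex.I ≠ 0 := by
    intro h
    have := congrArg Complex.im h
    simp at this
  have huI' : (u : ℂ) - Complex.I ≠ 0 := by
    intro h
    have := congrArg Complex.im h
    simp at this
  have hzI : z + Complex.I ≠ 0 := by
    intro h
    have := congrArg Complex.im h
    simp at this; linarith
  have huz : (u : ℂ) - z ≠ 0 := by
    intro h
    have := congrArg Complex.im h
    simp at this; linarith
  have hu2 : (u : ℂ) ^ 2 + 1 ≠ 0 := by
    have : (u : ℂ) ^ 2 + 1 = ((u : ℂ) + Complex.I) * ((u : ℂ) - Complex.I) := by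
      linear_combination Complex.I_sq
    rw [this]
    exact mul_ne_zero huI huI'
  have hζ' : ζ = ((u : ℂ) - Complex.I) / ((u : ℂ) + Complex.I) := by
    rw [eq_div_iff huI, hζu]
  simp only [hζ']
  have hA : ((u : ℂ) - Complex.I) / ((u : ℂ) + Complex.I) + (z - Complex.I) / (z + Complex.I)
      = 2 * (u * z + 1) / (((u : ℂ) + Complex.I) * (z + Complex.I)) := by
    field_simp
    linear_combination -2 * Complex.I_sq
  have hB : ((u : ℂ) - Complex.I) / ((u : ℂ) + Complex.I) - (z - Complex.I) / (z + Complex.I)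
      = 2 * Complex.I * (u - z) / (((u : ℂ) + Complex.I) * (z + Complex.I)) := by
    field_simp
    ring
  rw [hA, hB]
  have hI := Complex.I_ne_zero
  field_simp
  ring

/-- **Herglotz representation theorem**: every HP function has a spectral measure. -/
theorem HPFunction.exists_isSpectralMeasure (F : HPFunction) :
    ∃ μ : Measure ℝ, F.IsSpectralMeasure μ := by
  set g : ℂ → ℂ := fun w =>
    -Complex.I * F (UpperHalfPlane.ofComplex (Complex.I * (1 + w) / (1 - w))) with hg
  have hd : DifferentiableOn ℂ g (Metric.ball 0 1) := by
    refine DifferentiableOn.const_mul ?_ _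
    refine F.analytic'.comp (t := {z : ℂ | 0 < z.im})
      (f := fun w : ℂ => Complex.I * (1 + w) / (1 - w)) ?_ ?_
    · refine DifferentiableOn.div (by fun_prop) (by fun_prop) ?_
      intro w hw h
      have : w = 1 := (sub_eq_zero.1 h).symm
      simp [this] at hw
    · intro w hw
      exact im_cayley_pos (by simpa using hw)
  have hre : ∀ w ∈ Metric.ball (0 : ℂ) 1, 0 ≤ (g w).re := by
    intro w _
    simpa [hg] using F.im_nonneg' _
  obtain ⟨σ, hσ, hrep⟩ := exists_measure_circle_herglotz hd hre
  set one : Metric.sphere (0 : ℂ) 1 := ⟨1, by simp⟩ with hone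
  have hlin : Measurable (fun u : ℝ => ENNReal.ofReal (1 + u ^ 2)) := by fun_prop
  have hfin : ∀ ν : Measure ℝ, ∀ᵐ u : ℝ ∂ν, ENNReal.ofReal (1 + u ^ 2) < ⊤ := by simp
  refine ⟨((σ.restrict {one}ᶜ).map circleToLine).withDensity
    (fun u => ENNReal.ofReal (1 + u ^ 2)), ?_, (σ.real {one}), (F UpperHalfPlane.I).re,
    measureReal_nonneg, ?_⟩
  · rw [integrable_withDensity_iff_integrable_smul' hlin (hfin _)]
    have : (fun u : ℝ => (ENNReal.ofReal (1 + u ^ 2)).toReal • (u ^ 2 + 1)⁻¹) = fun _ => 1 := by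
      ext u
      rw [ENNReal.toReal_ofReal (by positivity), smul_eq_mul, add_comm]
      exact mul_inv_cancel₀ (by positivity)
    rw [this]
    exact integrable_const _
  · intro z
    have hz : 0 < (z : ℂ).im := z.im_pos
    have hzI : (z : ℂ) + Complex.I ≠ 0 := by
      intro h
      have := congrArg Complex.im h
      simp at this; linarith [z.im_pos]
    set w : ℂ := ((z : ℂ) - Complex.I) / ((z : ℂ) + Complex.I) with hw
    have hw1 : ‖w‖ < 1 := norm_inv_cayley_lt_one hz
    have hwz : Complex.I * (1 + w) / (1 - w) = z := by
      have h1 : 1 - w = 2 * Complex.I / ((z : ℂ) + Complex.I) := by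
        rw [hw]; field_simp; ring
      have h2 : 1 + w = 2 * z / ((z : ℂ) + Complex.I) := by
        rw [hw]; field_simp; ring
      rw [h1, h2]
      have hI := Complex.I_ne_zero
      field_simp
    have h1 := hrep w (by simpa using hw1)
    have hg0 : (g 0).im = -(F UpperHalfPlane.I).re := by
      have : UpperHalfPlane.ofComplex (Complex.I * (1 + 0) / (1 - 0)) = UpperHalfPlane.I := by
        rw [← UpperHalfPlane.ofComplex_apply UpperHalfPlane.I]
        simp
      simp only [hg, this]
      simp
    have hgw : g w = -Complex.I * F z := by
      simp only [hg, hwz, UpperHalfPlane.ofComplex_apply]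
    have hF : F z = ((F UpperHalfPlane.I).re : ℂ) +
        ∫ ζ : Metric.sphere (0 : ℂ) 1, Complex.I * (((ζ : ℂ) + w) / ((ζ : ℂ) - w)) ∂σ := by
      rw [hgw, hg0] at h1
      rw [integral_const_mul]
      have := congrArg (fun y => Complex.I * y) h1
      simp only [mul_add, ← mul_assoc] at this
      simp at this
      simpa using this
    have hint : Integrable
        (fun ζ : Metric.sphere (0 : ℂ) 1 => Complex.I * (((ζ : ℂ) + w) / ((ζ : ℂ) - w))) σ :=
      (BoundedContinuousFunction.integrable σ (BoundedContinuousFunction.mkOfCompact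
        (herglotzKernelCircle w hw1))).const_mul _
    have hmk : Measurable (fun u : ℝ => 1 / ((u : ℂ) - (z : ℂ)) - (u : ℂ) / ((u : ℂ) ^ 2 + 1)) := by
      fun_prop
    rw [hF, ← integral_add_compl (measurableSet_singleton one) hint, ← add_assoc,
      integral_withDensity_eq_integral_toReal_smul hlin (hfin _),
      integral_map measurable_circleToLine.aemeasurable]
    · congr 1
      · rw [integral_singleton]
        have : Complex.I * (((one : ℂ) + w) / ((one : ℂ) - w)) = z := by
          rw [← hwz, hone]; ring
        rw [this, Complex.real_smul]
      · refine setIntegral_congr_fun (measurableSet_singleton one).compl ?_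
        intro ζ hζ
        have hζ1 : (ζ : ℂ) ≠ 1 := fun h => hζ (Subtype.ext h)
        simp only [hw]
        rw [circleToLine_kernel hζ1 hz, ENNReal.toReal_ofReal (by positivity), Complex.real_smul]
        push_cast
        ring
    · exact (hlin.ennreal_toReal.smul hmk).aestronglyMeasurable

namespace HPFunction

theorem isSpectralMeasure_spectralMeasure (F : HPFunction) :
    F.IsSpectralMeasure F.spectralMeasure := by
  rw [spectralMeasure, dif_pos F.exists_isSpectralMeasure]
  exact F.exists_isSpectralMeasure.choose_spec

theorem integrable_inv_sq_add_one (F : HPFunction) :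
    Integrable (fun u : ℝ => (u ^ 2 + 1)⁻¹) F.spectralMeasure :=
  F.isSpectralMeasure_spectralMeasure.1

theorem continuous_inv_sq_add_one : Continuous (fun u : ℝ => (u ^ 2 + 1)⁻¹) :=
  Continuous.inv₀ (by fun_prop) (fun u => by positivity)

theorem integrable_mul_inv_sq_add_one (F : HPFunction) {h : ℝ → ℝ} (hh : Measurable h) {C : ℝ}
    (hC : ∀ u, |h u| ≤ C) : Integrable (fun u : ℝ => h u * (u ^ 2 + 1)⁻¹) F.spectralMeasure :=
  F.integrable_inv_sq_add_one.bdd_mul hh.aestronglyMeasurable (ae_of_all _ hC)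

theorem integrable_mul_inv_sq_add_one_complex (F : HPFunction) {h : ℝ → ℂ} (hh : Measurable h)
    {C : ℝ} (hC : ∀ u, ‖h u‖ ≤ C) :
    Integrable (fun u : ℝ => h u * (((u ^ 2 + 1)⁻¹ : ℝ) : ℂ)) F.spectralMeasure :=
  F.integrable_inv_sq_add_one.ofReal.bdd_mul hh.aestronglyMeasurable (ae_of_all _ hC)

instance (F : HPFunction) : IsFiniteMeasureOnCompacts F.spectralMeasure where
  lt_top_of_isCompact := by
    intro K hK
    obtain ⟨R, hR⟩ := hK.isBounded.exists_norm_le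
    have hpos : 0 < (R ^ 2 + 1)⁻¹ := by positivity
    refine lt_of_le_of_lt (measure_mono ?_) (F.integrable_inv_sq_add_one.measure_norm_ge_lt_top hpos)
    intro u hu
    have h1 : |u| ≤ R := hR u hu
    have h2 : u ^ 2 ≤ R ^ 2 := sq_le_sq' (by linarith [neg_abs_le u]) (by linarith [le_abs_self u])
    simp only [mem_ofPred_eq, Real.norm_eq_abs]
    rw [abs_of_pos (by positivity)]
    gcongr

theorem ofReal_sub_ne_zero (u : ℝ) (z : ℍ) : (u : ℂ) - z ≠ 0 := by
  intro h
  have := congrArg Complex.im h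
  simp at this
  linarith [z.im_pos]

theorem norm_div_ofReal_sub_le (u : ℝ) (z : ℍ) (c : ℂ) : ‖c / ((u : ℂ) - z)‖ ≤ ‖c‖ / z.im := by
  rw [norm_div]
  have h1 : z.im ≤ ‖(u : ℂ) - z‖ := by
    have := Complex.abs_im_le_norm ((u : ℂ) - z)
    simp [abs_of_pos z.im_pos] at this
    exact this
  have := z.im_pos
  gcongr

theorem integrable_kernel (F : HPFunction) (z : ℍ) :
    Integrable (fun u : ℝ => (1 + (z : ℂ) ^ 2) / ((u : ℂ) - z) * (((u ^ 2 + 1)⁻¹ : ℝ) : ℂ))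
      F.spectralMeasure :=
  F.integrable_mul_inv_sq_add_one_complex (by fun_prop) (fun u => norm_div_ofReal_sub_le u z _)

/-- The Herglotz formula, rewritten so that it only involves `F(i)` and an integral that is
continuous for the vague topology. -/
theorem apply_eq (F : HPFunction) (z : ℍ) :
    F z = ((F UpperHalfPlane.I).re : ℂ) + z * ((F UpperHalfPlane.I).im : ℂ) +
      ∫ u : ℝ, (1 + (z : ℂ) ^ 2) / ((u : ℂ) - z) * (((u ^ 2 + 1)⁻¹ : ℝ) : ℂ)
        ∂F.spectralMeasure := by
  obtain ⟨a, b, -, h⟩ := F.isSpectralMeasure_spectralMeasure.2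
  have hsplit : ∀ z : ℍ, F z = b + a * z +
      (z * ((∫ u : ℝ, (u ^ 2 + 1)⁻¹ ∂F.spectralMeasure : ℝ) : ℂ) +
        ∫ u : ℝ, (1 + (z : ℂ) ^ 2) / ((u : ℂ) - z) * (((u ^ 2 + 1)⁻¹ : ℝ) : ℂ)
        ∂F.spectralMeasure) := by
    intro z
    have hi : Integrable (fun u : ℝ => (z : ℂ) * (((u ^ 2 + 1)⁻¹ : ℝ) : ℂ)) F.spectralMeasure :=
      F.integrable_inv_sq_add_one.ofReal.const_mul _
    rw [h z, ← integral_complex_ofReal, ← integral_const_mul,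
      ← integral_add hi (F.integrable_kernel z)]
    congr 2
    ext u
    have h1 := ofReal_sub_ne_zero u z
    have h2 : (u : ℂ) ^ 2 + 1 ≠ 0 := by
      have : ((u ^ 2 + 1 : ℝ) : ℂ) ≠ 0 := Complex.ofReal_ne_zero.2 (by positivity)
      exact_mod_cast this
    push_cast
    field_simp
    ring
  have hI := hsplit UpperHalfPlane.I
  have h0 : (1 : ℂ) + ((UpperHalfPlane.I : ℍ) : ℂ) ^ 2 = 0 := by simp
  simp only [h0, zero_div, zero_mul, integral_zero, add_zero] at hI
  have hre := congrArg Complex.re hI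
  have him := congrArg Complex.im hI
  simp at hre him
  rw [hsplit z, hre, him]
  push_cast
  ring

theorem integral_inv_sq_add_one_le (F : HPFunction) :
    ∫ u : ℝ, (u ^ 2 + 1)⁻¹ ∂F.spectralMeasure ≤ (F UpperHalfPlane.I).im := by
  obtain ⟨a, b, ha, h⟩ := F.isSpectralMeasure_spectralMeasure.2
  have hI := h UpperHalfPlane.I
  have : ∫ u : ℝ, (1 / ((u : ℂ) - (UpperHalfPlane.I : ℍ)) - (u : ℂ) / ((u : ℂ) ^ 2 + 1))
      ∂F.spectralMeasure = Complex.I * ((∫ u : ℝ, (u ^ 2 + 1)⁻¹ ∂F.spectralMeasure : ℝ) : ℂ) := by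
    rw [← integral_complex_ofReal, ← integral_const_mul]
    congr 1
    ext u
    have h1 := ofReal_sub_ne_zero u UpperHalfPlane.I
    have h2 : (u : ℂ) ^ 2 + 1 ≠ 0 := by
      have : ((u ^ 2 + 1 : ℝ) : ℂ) ≠ 0 := Complex.ofReal_ne_zero.2 (by positivity)
      exact_mod_cast this
    rw [UpperHalfPlane.coe_I] at h1 ⊢
    push_cast
    field_simp
    linear_combination Complex.I_sq
  rw [this] at hI
  have him := congrArg Complex.im hI
  simp at him
  linarith

theorem continuous_integrals_apply_I : Continuous (fun F : HPFunction =>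
    ((fun f : C_c(ℝ, ℝ) => ∫ u : ℝ, f u ∂F.spectralMeasure), F UpperHalfPlane.I)) :=
  continuous_induced_dom

theorem continuous_apply_I : Continuous (fun F : HPFunction => F UpperHalfPlane.I) :=
  continuous_snd.comp continuous_integrals_apply_I

theorem continuous_integral_compactlySupported (f : ℝ → ℝ) (hf : Continuous f)
    (hc : HasCompactSupport f) :
    Continuous (fun F : HPFunction => ∫ u, f u ∂F.spectralMeasure) :=
  (continuous_apply (⟨⟨f, hf⟩, hc⟩ : C_c(ℝ, ℝ))).comp
    (continuous_fst.comp continuous_integrals_apply_I)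

/-- A continuous plateau function: `1` on `[x - r, x + r]` and `0` off `[x - r - s, x + r + s]`. -/
noncomputable def plateau (x r s u : ℝ) : ℝ := max 0 (min 1 ((r + s - |u - x|) / s))

theorem continuous_plateau (x r s : ℝ) : Continuous (plateau x r s) := by
  unfold plateau
  fun_prop

theorem plateau_nonneg (x r s u : ℝ) : 0 ≤ plateau x r s u := le_max_left _ _

theorem plateau_le_one (x r s u : ℝ) : plateau x r s u ≤ 1 :=
  max_le zero_le_one (min_le_left _ _)

theorem plateau_eq_one {x r s u : ℝ} (hs : 0 < s) (hu : |u - x| ≤ r) : plateau x r s u = 1 := by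
  have : 1 ≤ (r + s - |u - x|) / s := by rw [le_div_iff₀ hs]; linarith
  simp [plateau, min_eq_left this]

theorem plateau_eq_zero {x r s u : ℝ} (hs : 0 < s) (hu : r + s ≤ |u - x|) :
    plateau x r s u = 0 := by
  have : (r + s - |u - x|) / s ≤ 0 := div_nonpos_of_nonpos_of_nonneg (by linarith) hs.le
  exact max_eq_left ((min_le_right _ _).trans this)

theorem hasCompactSupport_plateau (x r : ℝ) {s : ℝ} (hs : 0 < s) :
    HasCompactSupport (plateau x r s) := by
  refine HasCompactSupport.intro (isCompact_closedBall x (r + s)) (fun u hu => ?_)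
  apply plateau_eq_zero hs
  simp [Real.dist_eq] at hu
  exact hu.le

/-- Integration of a function vanishing at infinity against `(u² + 1)⁻¹ μ(du)` is continuous
in the HP function. -/
theorem continuous_integral_mul_inv_sq_add_one {h : ℝ → ℝ} (hh : Continuous h)
    (h0 : Tendsto h (cocompact ℝ) (𝓝 0)) :
    Continuous (fun F : HPFunction => ∫ u, h u * (u ^ 2 + 1)⁻¹ ∂F.spectralMeasure) := by
  obtain ⟨C, hC⟩ : ∃ C, ∀ u, |h u| ≤ C := by
    let f : ZeroAtInftyContinuousMap ℝ ℝ := ⟨⟨h, hh⟩, h0⟩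
    exact ⟨‖f.toBCF‖, fun u => f.toBCF.norm_coe_le_norm u⟩
  refine continuous_of_locally_uniform_approx_of_continuousAt (fun F₀ V hV => ?_)
  obtain ⟨ε, hε, hεV⟩ := Metric.mem_uniformity_dist.1 hV
  set M : ℝ := (F₀ UpperHalfPlane.I).im + 1 with hM
  have hM0 : 0 < M := by have := F₀.im_nonneg' UpperHalfPlane.I; rw [hM]; linarith
  have hnear : {F : HPFunction | (F UpperHalfPlane.I).im < M} ∈ 𝓝 F₀ :=
    (isOpen_lt (Complex.continuous_im.comp continuous_apply_I) continuous_const).mem_nhds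
      (by simp [hM])
  have hev : ∀ᶠ u in cocompact ℝ, |h u| < ε / M := by
    have := (Metric.tendsto_nhds.1 h0) (ε / M) (by positivity)
    simpa using this
  obtain ⟨R, hR⟩ : ∃ R : ℝ, ∀ u, R < |u| → |h u| < ε / M := by
    rw [Filter.Eventually, mem_cocompact] at hev
    obtain ⟨K, hK, hKs⟩ := hev
    obtain ⟨R, hR⟩ := hK.isBounded.exists_norm_le
    refine ⟨R, fun u hu => hKs (fun huK => ?_)⟩
    exact absurd (hR u huK) (not_le.2 hu)
  refine ⟨_, hnear, fun F => ∫ u, h u * plateau 0 R 1 u * (u ^ 2 + 1)⁻¹ ∂F.spectralMeasure,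
    Continuous.continuousAt ?_, fun F hF => hεV ?_⟩
  · refine continuous_integral_compactlySupported _ ?_ ?_
    · exact (hh.mul (continuous_plateau _ _ _)).mul continuous_inv_sq_add_one
    · exact ((hasCompactSupport_plateau 0 R one_pos).mul_left).mul_right
  · have hp : ∀ u, |h u * plateau 0 R 1 u| ≤ C := by
      intro u
      rw [abs_mul, abs_of_nonneg (plateau_nonneg _ _ _ _)]
      exact (mul_le_of_le_one_right (abs_nonneg _) (plateau_le_one _ _ _ _)).trans (hC u)
    have hi1 := F.integrable_mul_inv_sq_add_one hh.measurable hC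
    have hi2 : Integrable (fun u : ℝ => h u * plateau 0 R 1 u * (u ^ 2 + 1)⁻¹)
        F.spectralMeasure := F.integrable_mul_inv_sq_add_one
      (hh.mul (continuous_plateau 0 R 1)).measurable hp
    rw [Real.dist_eq, ← integral_sub hi1 hi2]
    have hb : ∀ u : ℝ, ‖h u * (u ^ 2 + 1)⁻¹ - h u * plateau 0 R 1 u * (u ^ 2 + 1)⁻¹‖
        ≤ ε / M * (u ^ 2 + 1)⁻¹ := by
      intro u
      have hpos : 0 < (u ^ 2 + 1)⁻¹ := by positivity
      rw [show h u * (u ^ 2 + 1)⁻¹ - h u * plateau 0 R 1 u * (u ^ 2 + 1)⁻¹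
        = h u * (1 - plateau 0 R 1 u) * (u ^ 2 + 1)⁻¹ by ring, norm_mul, norm_mul,
        Real.norm_eq_abs, Real.norm_eq_abs, Real.norm_eq_abs, abs_of_pos hpos]
      refine mul_le_mul_of_nonneg_right ?_ hpos.le
      rcases le_or_gt |u| R with hu | hu
      · rw [plateau_eq_one one_pos (by simpa using hu)]
        simp; positivity
      · rw [abs_of_nonneg (sub_nonneg.2 (plateau_le_one _ _ _ _))]
        refine (mul_le_of_le_one_right (abs_nonneg _) ?_).trans (hR u hu).le
        linarith [plateau_nonneg 0 R 1 u]
    have h1 := norm_integral_le_of_norm_le (F.integrable_inv_sq_add_one.const_mul (ε / M))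
      (ae_of_all _ hb)
    rw [integral_const_mul] at h1
    refine lt_of_le_of_lt h1 ?_
    have h2 := F.integral_inv_sq_add_one_le
    have h3 : (F UpperHalfPlane.I).im < M := hF
    calc ε / M * ∫ u : ℝ, (u ^ 2 + 1)⁻¹ ∂F.spectralMeasure
        < ε / M * M := by
          apply mul_lt_mul_of_pos_left _ (by positivity)
          linarith
      _ = ε := by field_simp

theorem continuous_integral_mul_inv_sq_add_one_complex {h : ℝ → ℂ} (hh : Continuous h)
    (h0 : Tendsto h (cocompact ℝ) (𝓝 0)) :
    Continuous (fun F : HPFunction =>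
      ∫ u, h u * (((u ^ 2 + 1)⁻¹ : ℝ) : ℂ) ∂F.spectralMeasure) := by
  obtain ⟨C, hC⟩ : ∃ C, ∀ u, ‖h u‖ ≤ C := by
    let f : ZeroAtInftyContinuousMap ℝ ℂ := ⟨⟨h, hh⟩, h0⟩
    exact ⟨‖f.toBCF‖, fun u => f.toBCF.norm_coe_le_norm u⟩
  have h1 := continuous_integral_mul_inv_sq_add_one (Complex.continuous_re.comp hh)
    (by simpa using (Complex.continuous_re.tendsto 0).comp h0)
  have h2 := continuous_integral_mul_inv_sq_add_one (Complex.continuous_im.comp hh)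
    (by simpa using (Complex.continuous_im.tendsto 0).comp h0)
  have : ∀ F : HPFunction, ∫ u, h u * (((u ^ 2 + 1)⁻¹ : ℝ) : ℂ) ∂F.spectralMeasure =
      ((∫ u, (Complex.re ∘ h) u * (u ^ 2 + 1)⁻¹ ∂F.spectralMeasure : ℝ) : ℂ) +
      ((∫ u, (Complex.im ∘ h) u * (u ^ 2 + 1)⁻¹ ∂F.spectralMeasure : ℝ) : ℂ) * Complex.I := by
    intro F
    have := integral_re_add_im (𝕜 := ℂ)
      (F.integrable_mul_inv_sq_add_one_complex hh.measurable hC)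
    rw [← this]
    simp only [RCLike.re_eq_complex_re, RCLike.im_eq_complex_im, Complex.re_mul_ofReal,
      Complex.im_mul_ofReal]
    rfl
  simp only [this]
  fun_prop

/-- Evaluation at a point of the upper half plane is continuous. -/
theorem continuous_eval (z : ℍ) : Continuous (fun F : HPFunction => F z) := by
  have hk : Continuous (fun u : ℝ => (1 + (z : ℂ) ^ 2) / ((u : ℂ) - z)) :=
    Continuous.div (by fun_prop) (by fun_prop) (fun u => ofReal_sub_ne_zero u z)
  have hk0 : Tendsto (fun u : ℝ => (1 + (z : ℂ) ^ 2) / ((u : ℂ) - z)) (cocompact ℝ) (𝓝 0) := by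
    rw [← Metric.cobounded_eq_cocompact]
    have h1 : Tendsto (fun u : ℝ => (u : ℂ) - z) (Bornology.cobounded ℝ)
        (Bornology.cobounded ℂ) := by
      rw [← tendsto_norm_atTop_iff_cobounded]
      have h2 : Tendsto (fun u : ℝ => ‖u‖ - ‖(z : ℂ)‖) (Bornology.cobounded ℝ) atTop :=
        tendsto_atTop_add_const_right _ _ tendsto_norm_cobounded_atTop
      refine tendsto_atTop_mono (fun u => ?_) h2
      have := norm_sub_norm_le (u : ℂ) z
      simpa using this
    have h3 := (tendsto_inv₀_cobounded.comp h1).const_mul (1 + (z : ℂ) ^ 2)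
    simpa [div_eq_mul_inv] using h3
  have h1 := continuous_integral_mul_inv_sq_add_one_complex hk hk0
  have h2 := continuous_apply_I
  simp only [apply_eq _ z]
  fun_prop

end HPFunction

/-- Positive rationals tending to `0`. -/
def posRatNhdsZero : Filter {q : ℚ // 0 < q} := comap (fun q => ((q : ℚ) : ℝ)) (𝓝[>] 0)

instance : posRatNhdsZero.IsCountablyGenerated := by
  unfold posRatNhdsZero
  infer_instance

instance : posRatNhdsZero.NeBot := by
  unfold posRatNhdsZero
  rw [comap_neBot_iff]
  intro t ht
  obtain ⟨δ, hδ, hδt⟩ := mem_nhdsGT_iff_exists_Ioo_subset.1 ht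
  obtain ⟨q, hq0, hq1⟩ := exists_rat_btwn (show (0 : ℝ) < δ from hδ)
  exact ⟨⟨q, by exact_mod_cast hq0⟩, hδt ⟨hq0, hq1⟩⟩

theorem tendsto_posRatNhdsZero : Tendsto (fun q : {q : ℚ // 0 < q} => ((q : ℚ) : ℝ))
    posRatNhdsZero (𝓝[>] 0) := tendsto_comap

theorem tendsto_nhdsGT_of_tendsto_posRat {c : ℝ → ℂ} (hc : ContinuousOn c (Ioi 0)) {w : ℂ}
    (h : Tendsto (fun q : {q : ℚ // 0 < q} => c ((q : ℚ) : ℝ)) posRatNhdsZero (𝓝 w)) :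
    Tendsto c (𝓝[>] 0) (𝓝 w) := by
  rw [Metric.tendsto_nhds]
  intro ε hε
  have h1 := Metric.tendsto_nhds.1 h (ε / 2) (by positivity)
  rw [posRatNhdsZero, eventually_comap] at h1
  obtain ⟨δ, hδ, hδt⟩ := mem_nhdsGT_iff_exists_Ioo_subset.1 h1
  refine mem_nhdsGT_iff_exists_Ioo_subset.2 ⟨δ, hδ, fun η hη => ?_⟩
  have hca : ContinuousAt c η := hc.continuousAt (Ioi_mem_nhds hη.1)
  have h2 : ∀ᶠ y in 𝓝 η, dist (c y) (c η) < ε / 2 :=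
    Metric.tendsto_nhds.1 hca.tendsto (ε / 2) (by positivity)
  obtain ⟨_, ⟨q, rfl⟩, hy1, hy2⟩ := Rat.isDenseEmbedding_coe_real.dense.inter_nhds_nonempty
    (Filter.inter_mem h2 (Ioo_mem_nhds hη.1 hη.2))
  have hq : 0 < q := by exact_mod_cast hy2.1
  have h3 := hδt hy2 ⟨q, hq⟩ rfl
  calc dist (c η) w ≤ dist (c η) (c q) + dist (c q) w := dist_triangle _ _ _
    _ < ε / 2 + ε / 2 := by
      have hy1' : dist (c (q : ℝ)) (c η) < ε / 2 := hy1
      rw [dist_comm] at hy1'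
      exact add_lt_add hy1' h3
    _ = ε := by ring

namespace HPFunction

theorem continuousOn_vertical (F : HPFunction) (x : ℝ) : ContinuousOn
    (fun η : ℝ => F (UpperHalfPlane.ofComplex ((x : ℂ) + (η : ℂ) * Complex.I))) (Ioi 0) := by
  refine F.analytic'.continuousOn.comp (f := fun η : ℝ => (x : ℂ) + (η : ℂ) * Complex.I)
    (by fun_prop) (fun η hη => ?_)
  simpa using hη

theorem hasBoundaryValue_iff (F : HPFunction) (x : ℝ) (w : ℂ) :
    F.HasBoundaryValue x w ↔ Tendsto (fun q : {q : ℚ // 0 < q} =>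
      F (UpperHalfPlane.ofComplex ((x : ℂ) + (((q : ℚ) : ℝ) : ℂ) * Complex.I)))
      posRatNhdsZero (𝓝 w) :=
  ⟨fun h => h.comp tendsto_posRatNhdsZero,
    tendsto_nhdsGT_of_tendsto_posRat (F.continuousOn_vertical x)⟩

theorem HasBoundaryValue.boundaryValue_eq {F : HPFunction} {x : ℝ} {w : ℂ}
    (h : F.HasBoundaryValue x w) : F.boundaryValue x = w := by
  have hex : ∃ w, F.HasBoundaryValue x w := ⟨w, h⟩
  rw [boundaryValue, dif_pos hex]
  exact tendsto_nhds_unique hex.choose_spec h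

theorem measurableSet_exists_hasBoundaryValue (x : ℝ) :
    MeasurableSet {F : HPFunction | ∃ w, F.HasBoundaryValue x w} := by
  simp only [hasBoundaryValue_iff]
  exact measurableSet_exists_tendsto (fun q => (continuous_eval _).measurable)

theorem measurable_boundaryValue (x : ℝ) :
    Measurable (fun F : HPFunction => F.boundaryValue x) := by
  have hE := measurableSet_exists_hasBoundaryValue x
  refine measurable_of_tendsto_metrizable' posRatNhdsZero (f := fun q : {q : ℚ // 0 < q} =>
    {F : HPFunction | ∃ w, F.HasBoundaryValue x w}.indicator (fun F =>
      F (UpperHalfPlane.ofComplex ((x : ℂ) + (((q : ℚ) : ℝ) : ℂ) * Complex.I))))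
    (fun q => (continuous_eval _).measurable.indicator hE) ?_
  rw [tendsto_pi_nhds]
  intro F
  by_cases hF : ∃ w, F.HasBoundaryValue x w
  · have hmem : F ∈ {F : HPFunction | ∃ w, F.HasBoundaryValue x w} := hF
    simp only [indicator_of_mem hmem]
    obtain ⟨w, hw⟩ := hF
    rw [hw.boundaryValue_eq]
    exact (F.hasBoundaryValue_iff x w).1 hw
  · have hmem : F ∉ {F : HPFunction | ∃ w, F.HasBoundaryValue x w} := hF
    simp only [indicator_of_notMem hmem, boundaryValue, dif_neg hF]
    exact tendsto_const_nhds

end HPFunction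

/-- The kernel `1 / (u - x)`, made continuous within distance `δ` of `x`. -/
noncomputable def cutKernel (x δ u : ℝ) : ℝ := (u - x) / max ((u - x) ^ 2) (δ ^ 2)

theorem continuous_cutKernel (x : ℝ) {δ : ℝ} (hδ : 0 < δ) : Continuous (cutKernel x δ) :=
  Continuous.div (by fun_prop) (by fun_prop)
    (fun u => (lt_of_lt_of_le (by positivity) (le_max_right _ _)).ne')

theorem cutKernel_eq {x δ u : ℝ} (hδ : 0 < δ) (hu : δ ≤ |u - x|) :
    cutKernel x δ u = (u - x)⁻¹ := by
  have h1 : δ ^ 2 ≤ (u - x) ^ 2 := by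
    rw [← sq_abs (u - x)]
    gcongr
  have h2 : u - x ≠ 0 := abs_pos.1 (hδ.trans_le hu)
  rw [cutKernel, max_eq_left h1]
  field_simp

theorem tendsto_cutKernel_cocompact (x : ℝ) {δ : ℝ} (hδ : 0 < δ) :
    Tendsto (cutKernel x δ) (cocompact ℝ) (𝓝 0) := by
  have h1 : Tendsto (fun u : ℝ => |u - x|) (cocompact ℝ) atTop := by
    have h2 : Tendsto (fun u : ℝ => ‖u‖ - ‖x‖) (cocompact ℝ) atTop :=
      tendsto_atTop_add_const_right _ _ (tendsto_norm_cocompact_atTop)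
    exact tendsto_atTop_mono (fun u => norm_sub_norm_le u x) h2
  refine squeeze_zero_norm' ?_ (tendsto_inv_atTop_zero.comp h1)
  filter_upwards [h1.eventually_ge_atTop δ] with u hu
  simp [cutKernel_eq hδ hu]

namespace HPFunction

/-- The boundary value at `x`, with the singularity of the kernel cut off at distance `δ`. -/
noncomputable def cutBoundaryValue (x δ : ℝ) (F : HPFunction) : ℂ :=
  ((F UpperHalfPlane.I).re : ℂ) + x * ((F UpperHalfPlane.I).im : ℂ) +
    (((1 + x ^ 2) * ∫ u : ℝ, cutKernel x δ u * (u ^ 2 + 1)⁻¹ ∂F.spectralMeasure : ℝ) : ℂ)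

theorem continuous_cutBoundaryValue (x : ℝ) {δ : ℝ} (hδ : 0 < δ) :
    Continuous (cutBoundaryValue x δ) := by
  have h1 := continuous_integral_mul_inv_sq_add_one (continuous_cutKernel x hδ)
    (tendsto_cutKernel_cocompact x hδ)
  have h2 := continuous_apply_I
  unfold cutBoundaryValue
  fun_prop

/-- If the spectral measure has no mass within distance `δ` of `x`, then `F(x + i0)` exists. -/
theorem hasBoundaryValue_cutBoundaryValue (F : HPFunction) {x δ : ℝ} (hδ : 0 < δ)
    (h : F.spectralMeasure (Icc (x - δ) (x + δ)) = 0) :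
    F.HasBoundaryValue x (cutBoundaryValue x δ F) := by
  have hae : ∀ᵐ u ∂F.spectralMeasure, δ ≤ |u - x| := by
    rw [ae_iff]
    refine measure_mono_null (fun u hu => ?_) h
    have h1 := abs_lt.1 (not_le.1 hu)
    exact ⟨by linarith, by linarith⟩
  have hcut : cutBoundaryValue x δ F = ((F UpperHalfPlane.I).re : ℂ) +
      ((x : ℂ) + ((0 : ℝ) : ℂ) * Complex.I) * ((F UpperHalfPlane.I).im : ℂ) +
      ∫ u : ℝ, (1 + ((x : ℂ) + ((0 : ℝ) : ℂ) * Complex.I) ^ 2) /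
        ((u : ℂ) - ((x : ℂ) + ((0 : ℝ) : ℂ) * Complex.I)) * (((u ^ 2 + 1)⁻¹ : ℝ) : ℂ)
        ∂F.spectralMeasure := by
    rw [cutBoundaryValue, ← integral_const_mul, ← integral_complex_ofReal]
    simp only [Complex.ofReal_zero, zero_mul, add_zero]
    congr 1
    refine integral_congr_ae ?_
    filter_upwards [hae] with u hu
    rw [cutKernel_eq hδ hu]
    push_cast
    rw [div_eq_mul_inv]
    ring
  rw [HasBoundaryValue, hcut]
  have heq : ∀ᶠ η : ℝ in 𝓝[>] 0, ((F UpperHalfPlane.I).re : ℂ) +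
      ((x : ℂ) + (η : ℂ) * Complex.I) * ((F UpperHalfPlane.I).im : ℂ) +
      ∫ u : ℝ, (1 + ((x : ℂ) + (η : ℂ) * Complex.I) ^ 2) /
        ((u : ℂ) - ((x : ℂ) + (η : ℂ) * Complex.I)) * (((u ^ 2 + 1)⁻¹ : ℝ) : ℂ)
        ∂F.spectralMeasure =
      F (UpperHalfPlane.ofComplex ((x : ℂ) + (η : ℂ) * Complex.I)) := by
    filter_upwards [self_mem_nhdsWithin] with η hη
    have hz : 0 < ((x : ℂ) + (η : ℂ) * Complex.I).im := by simpa using hη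
    rw [UpperHalfPlane.ofComplex_apply_of_im_pos hz, F.apply_eq ⟨_, hz⟩]
  refine Tendsto.congr' heq ?_
  have hcoe : Tendsto (fun η : ℝ => (x : ℂ) + (η : ℂ) * Complex.I) (𝓝[>] 0)
      (𝓝 ((x : ℂ) + ((0 : ℝ) : ℂ) * Complex.I)) :=
    (Continuous.tendsto (by fun_prop) 0).mono_left nhdsWithin_le_nhds
  refine (tendsto_const_nhds.add (hcoe.mul_const _)).add ?_
  refine tendsto_integral_filter_of_dominated_convergence
    (fun u => ((1 + (|x| + 1) ^ 2) / δ) * (u ^ 2 + 1)⁻¹) ?_ ?_ ?_ ?_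
  · refine Eventually.of_forall (fun η => Measurable.aestronglyMeasurable (by fun_prop))
  · have hη1 : ∀ᶠ η : ℝ in 𝓝[>] 0, η < 1 :=
      nhdsWithin_le_nhds (Iio_mem_nhds one_pos)
    filter_upwards [self_mem_nhdsWithin, hη1] with η hη hη1
    filter_upwards [hae] with u hu
    have hpos : 0 < (u ^ 2 + 1)⁻¹ := by positivity
    rw [norm_mul, Complex.norm_real, Real.norm_eq_abs, abs_of_pos hpos, norm_div]
    have h1 : δ ≤ ‖(u : ℂ) - ((x : ℂ) + (η : ℂ) * Complex.I)‖ := by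
      refine hu.trans ?_
      have := Complex.abs_re_le_norm ((u : ℂ) - ((x : ℂ) + (η : ℂ) * Complex.I))
      simpa using this
    have h2 : ‖(x : ℂ) + (η : ℂ) * Complex.I‖ ≤ |x| + 1 := by
      refine (norm_add_le _ _).trans ?_
      have : |η| ≤ 1 := by rw [abs_of_pos hη]; exact hη1.le
      simpa using this
    have h3 : ‖1 + ((x : ℂ) + (η : ℂ) * Complex.I) ^ 2‖ ≤ 1 + (|x| + 1) ^ 2 := by
      refine (norm_add_le _ _).trans ?_
      rw [norm_one, norm_pow]
      gcongr
    gcongr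
  · exact F.integrable_inv_sq_add_one.const_mul _
  · filter_upwards [hae] with u hu
    refine Tendsto.mul_const _ (Tendsto.div ?_ ?_ ?_)
    · exact (hcoe.pow 2).const_add 1
    · exact hcoe.const_sub _
    · have h2 : u - x ≠ 0 := abs_pos.1 (hδ.trans_le hu)
      have : (((u - x : ℝ)) : ℂ) ≠ 0 := Complex.ofReal_ne_zero.2 h2
      simpa using this

/-- The integral of a plateau function around `x`, truncated at `1`. -/
noncomputable def nearMass (x δ : ℝ) (F : HPFunction) : ℝ :=
  min (∫ u, plateau x δ δ u ∂F.spectralMeasure) 1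

theorem continuous_nearMass (x : ℝ) {δ : ℝ} (hδ : 0 < δ) : Continuous (nearMass x δ) :=
  (continuous_integral_compactlySupported _ (continuous_plateau x δ δ)
    (hasCompactSupport_plateau x δ hδ)).min continuous_const

theorem nearMass_nonneg (x δ : ℝ) (F : HPFunction) : 0 ≤ nearMass x δ F :=
  le_min (integral_nonneg (plateau_nonneg x δ δ)) zero_le_one

theorem nearMass_le_one (x δ : ℝ) (F : HPFunction) : nearMass x δ F ≤ 1 := min_le_right _ _

theorem integrable_plateau (F : HPFunction) (x r : ℝ) {s : ℝ} (hs : 0 < s) :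
    Integrable (plateau x r s) F.spectralMeasure :=
  (continuous_plateau x r s).integrable_of_hasCompactSupport (hasCompactSupport_plateau x r hs)

theorem measure_Icc_eq_zero_of_nearMass_lt_one {F : HPFunction} {a b x δ : ℝ}
    (hF : IsSimplePointMeasureOn F.spectralMeasure a b) (hδ : 0 < δ)
    (ha : a ≤ x - δ) (hb : x + δ ≤ b) (h : nearMass x δ F < 1) :
    F.spectralMeasure (Icc (x - δ) (x + δ)) = 0 := by
  obtain ⟨S, hS⟩ := hF
  have h1 : F.spectralMeasure (Icc (x - δ) (x + δ))
      = ∑ p ∈ S, Measure.dirac p (Icc (x - δ) (x + δ)) := by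
    rw [← Measure.finsetSum_apply, ← hS, Measure.restrict_apply measurableSet_Icc,
      inter_eq_left.2 (Icc_subset_Icc ha hb)]
  rw [h1, Finset.sum_eq_zero_iff]
  intro p hp
  by_contra hne
  have hpm : p ∈ Icc (x - δ) (x + δ) := by
    by_contra hpn
    exact hne (by simp [hpn])
  have h2 : 1 ≤ F.spectralMeasure (Icc (x - δ) (x + δ)) := by
    rw [h1]
    refine le_trans ?_ (Finset.single_le_sum (fun _ _ => zero_le) hp)
    simp [hpm]
  have hfin : F.spectralMeasure (Icc (x - δ) (x + δ)) < ⊤ := isCompact_Icc.measure_lt_top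
  have h3 : 1 ≤ F.spectralMeasure.real (Icc (x - δ) (x + δ)) := by
    rw [measureReal_def, ← ENNReal.toReal_one]
    exact ENNReal.toReal_mono hfin.ne h2
  have h4 : F.spectralMeasure.real (Icc (x - δ) (x + δ)) ≤
      ∫ u, plateau x δ δ u ∂F.spectralMeasure := by
    rw [← integral_indicator_one measurableSet_Icc]
    refine integral_mono ((integrable_indicator_iff measurableSet_Icc).2
      (integrableOn_const hfin.ne)) (F.integrable_plateau x δ hδ) (fun u => ?_)
    by_cases hu : u ∈ Icc (x - δ) (x + δ)
    · rw [indicator_of_mem hu, plateau_eq_one hδ (abs_le.2 ⟨by linarith [hu.1], by linarith [hu.2]⟩)]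
      rfl
    · rw [indicator_of_notMem hu]
      exact plateau_nonneg _ _ _ _
  rw [nearMass, min_lt_iff] at h
  rcases h with h | h <;> linarith

/-- A sequence of radii decreasing to `0`. -/
noncomputable def radius (k : ℕ) : ℝ := 1 / ((k : ℝ) + 1)

theorem radius_pos (k : ℕ) : 0 < radius k := by unfold radius; positivity

theorem tendsto_radius : Tendsto radius atTop (𝓝 0) := tendsto_one_div_add_atTop_nhds_zero_nat

theorem tendsto_integral_plateau (F : HPFunction) (x : ℝ) :
    Tendsto (fun k => ∫ u, plateau x (radius k) (radius k) u ∂F.spectralMeasure) atTop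
      (𝓝 (F.spectralMeasure.real {x})) := by
  rw [← integral_indicator_one (measurableSet_singleton x)]
  refine tendsto_integral_of_dominated_convergence (plateau x 2 1) ?_
    (F.integrable_plateau x 2 one_pos) ?_ ?_
  · exact fun k => (continuous_plateau _ _ _).aestronglyMeasurable
  · refine fun k => ae_of_all _ (fun u => ?_)
    rw [Real.norm_eq_abs, abs_of_nonneg (plateau_nonneg _ _ _ _)]
    rcases le_or_gt |u - x| 2 with hu | hu
    · rw [plateau_eq_one one_pos hu]
      exact plateau_le_one _ _ _ _
    · have : radius k ≤ 1 := by
        rw [radius, div_le_one (by positivity)]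
        linarith [(Nat.cast_nonneg k : (0 : ℝ) ≤ k)]
      rw [plateau_eq_zero (radius_pos k) (by linarith)]
      exact plateau_nonneg _ _ _ _
  · refine ae_of_all _ (fun u => ?_)
    by_cases hu : u = x
    · subst hu
      refine tendsto_const_nhds.congr (fun k => ?_)
      rw [plateau_eq_one (radius_pos k) (by simpa using (radius_pos k).le)]
      simp
    · rw [indicator_of_notMem (by simpa using hu)]
      have h1 : 0 < |u - x| := abs_pos.2 (sub_ne_zero.2 hu)
      refine tendsto_const_nhds.congr' ?_
      filter_upwards [tendsto_radius.eventually (Iio_mem_nhds (half_pos h1))] with k hk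
      have hk' : radius k < |u - x| / 2 := hk
      rw [plateau_eq_zero (radius_pos k) (by linarith)]

theorem measurable_spectralMeasure_singleton (x : ℝ) :
    Measurable (fun F : HPFunction => F.spectralMeasure {x}) := by
  have h1 : Measurable (fun F : HPFunction => F.spectralMeasure.real {x}) := by
    refine measurable_of_tendsto_metrizable (f := fun k (F : HPFunction) =>
      ∫ u, plateau x (radius k) (radius k) u ∂F.spectralMeasure) (fun k => ?_) ?_
    · exact (continuous_integral_compactlySupported _ (continuous_plateau _ _ _)
        (hasCompactSupport_plateau x _ (radius_pos k))).measurable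
    · exact tendsto_pi_nhds.2 (fun F => F.tendsto_integral_plateau x)
  have h2 : (fun F : HPFunction => F.spectralMeasure {x}) =
      fun F : HPFunction => ENNReal.ofReal (F.spectralMeasure.real {x}) := by
    ext F
    rw [ofReal_measureReal (isCompact_singleton.measure_lt_top).ne]
  rw [h2]
  exact h1.ennreal_ofReal

theorem tendsto_nearMass {F : HPFunction} {x : ℝ} (h : F.spectralMeasure {x} = 0) :
    Tendsto (fun k => nearMass x (radius k) F) atTop (𝓝 0) := by
  have h1 := F.tendsto_integral_plateau x
  rw [measureReal_def, h, ENNReal.toReal_zero] at h1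
  simpa [nearMass] using h1.min (tendsto_const_nhds (x := (1 : ℝ)))

end HPFunction

theorem MeasureTheory.TendstoInDistribution.tendsto_integral {ι E Ω' : Type*} {Ω : ι → Type*}
    {m : ∀ i, MeasurableSpace (Ω i)} {μ : (i : ι) → Measure (Ω i)}
    [∀ i, IsProbabilityMeasure (μ i)] {m' : MeasurableSpace Ω'} {μ' : Measure Ω'}
    [IsProbabilityMeasure μ'] [TopologicalSpace E] [MeasurableSpace E] [OpensMeasurableSpace E]
    {X : (i : ι) → Ω i → E} {Z : Ω' → E} {l : Filter ι}
    (h : TendstoInDistribution X l Z μ μ') (g : BoundedContinuousFunction E ℝ) :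
    Tendsto (fun n => ∫ ω, g (X n ω) ∂(μ n)) l (𝓝 (∫ ω, g (Z ω) ∂μ')) := by
  have h1 := ProbabilityMeasure.tendsto_iff_forall_integral_tendsto.1 h.tendsto g
  have hg : ∀ ν : Measure E, AEStronglyMeasurable g ν :=
    fun ν => g.continuous.measurable.aestronglyMeasurable
  simp only [ProbabilityMeasure.coe_mk] at h1
  rw [integral_map h.aemeasurable_limit (hg _)] at h1
  refine h1.congr (fun n => ?_)
  rw [integral_map (h.forall_aemeasurable n) (hg _)]

namespace HPFunction

theorem exists_hasBoundaryValue_of_nearMass_lt_one {F : HPFunction} {a b x δ : ℝ}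
    (hF : IsSimplePointMeasureOn F.spectralMeasure a b) (hδ : 0 < δ)
    (ha : a ≤ x - δ) (hb : x + δ ≤ b) (h : nearMass x δ F < 1) :
    F.HasBoundaryValue x (cutBoundaryValue x δ F) :=
  F.hasBoundaryValue_cutBoundaryValue hδ (measure_Icc_eq_zero_of_nearMass_lt_one hF hδ ha hb h)

theorem abs_sub_cutBoundaryValue_le (f : BoundedContinuousFunction ℂ ℝ) {F : HPFunction}
    {a b x δ : ℝ} (hF : IsSimplePointMeasureOn F.spectralMeasure a b) (hδ : 0 < δ)
    (ha : a ≤ x - δ) (hb : x + δ ≤ b) :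
    |f (F.boundaryValue x) - f (cutBoundaryValue x δ F)| ≤ 2 * ‖f‖ * nearMass x δ F := by
  rcases (nearMass_le_one x δ F).lt_or_eq with h | h
  · rw [(exists_hasBoundaryValue_of_nearMass_lt_one hF hδ ha hb h).boundaryValue_eq]
    simpa using mul_nonneg (by positivity) (nearMass_nonneg x δ F)
  · rw [h, mul_one, ← Real.dist_eq]
    exact f.dist_le_two_norm _ _

section RandomFunction

variable {Ω : Type*} [MeasurableSpace Ω] {P : Measure Ω} [IsProbabilityMeasure P]
  {G : Ω → HPFunction}

theorem integrable_nearMass (hG : AEMeasurable G P) (x : ℝ) {δ : ℝ} (hδ : 0 < δ) :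
    Integrable (fun ω => nearMass x δ (G ω)) P := by
  refine Integrable.of_bound
    ((continuous_nearMass x hδ).measurable.comp_aemeasurable hG).aestronglyMeasurable 1
    (ae_of_all _ (fun ω => ?_))
  rw [Real.norm_eq_abs, abs_of_nonneg (nearMass_nonneg x δ _)]
  exact nearMass_le_one x δ _

theorem abs_integral_sub_cutBoundaryValue_le (f : BoundedContinuousFunction ℂ ℝ)
    (hG : AEMeasurable G P) {a b x δ : ℝ}
    (hS : ∀ᵐ ω ∂P, IsSimplePointMeasureOn (G ω).spectralMeasure a b) (hδ : 0 < δ)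
    (ha : a ≤ x - δ) (hb : x + δ ≤ b) :
    |∫ ω, f ((G ω).boundaryValue x) ∂P - ∫ ω, f (cutBoundaryValue x δ (G ω)) ∂P|
      ≤ 2 * ‖f‖ * ∫ ω, nearMass x δ (G ω) ∂P := by
  have hi1 : Integrable (fun ω => f ((G ω).boundaryValue x)) P :=
    Integrable.of_bound (f.continuous.measurable.comp_aemeasurable
      ((measurable_boundaryValue x).comp_aemeasurable hG)).aestronglyMeasurable ‖f‖
      (ae_of_all _ (fun ω => f.norm_coe_le_norm _))
  have hi2 : Integrable (fun ω => f (cutBoundaryValue x δ (G ω))) P :=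
    Integrable.of_bound (f.continuous.measurable.comp_aemeasurable
      ((continuous_cutBoundaryValue x hδ).measurable.comp_aemeasurable hG)).aestronglyMeasurable
      ‖f‖ (ae_of_all _ (fun ω => f.norm_coe_le_norm _))
  rw [← integral_sub hi1 hi2, ← integral_const_mul, ← Real.norm_eq_abs]
  refine norm_integral_le_of_norm_le ((integrable_nearMass hG x hδ).const_mul _) ?_
  filter_upwards [hS] with ω hω
  exact abs_sub_cutBoundaryValue_le f hω hδ ha hb

theorem measure_not_exists_hasBoundaryValue_le (hG : AEMeasurable G P) {a b x δ : ℝ}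
    (hS : ∀ᵐ ω ∂P, IsSimplePointMeasureOn (G ω).spectralMeasure a b) (hδ : 0 < δ)
    (ha : a ≤ x - δ) (hb : x + δ ≤ b) :
    P {ω | ¬ ∃ w : ℂ, (G ω).HasBoundaryValue x w} ≤
      ENNReal.ofReal (∫ ω, nearMass x δ (G ω) ∂P) := by
  have hae : {ω | ¬ ∃ w : ℂ, (G ω).HasBoundaryValue x w} ≤ᵐ[P]
      {ω | 1 ≤ ENNReal.ofReal (nearMass x δ (G ω))} := by
    filter_upwards [hS] with ω hω hω'
    by_contra hlt
    refine hω' ⟨_, exists_hasBoundaryValue_of_nearMass_lt_one hω hδ ha hb ?_⟩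
    exact ENNReal.ofReal_lt_one.1 (not_le.1 hlt)
  refine (measure_mono_ae hae).trans ?_
  rw [ofReal_integral_eq_lintegral_ofReal (integrable_nearMass hG x hδ)
    (ae_of_all _ (fun ω => nearMass_nonneg x δ _))]
  have := mul_meas_ge_le_lintegral₀
    ((continuous_nearMass x hδ).measurable.comp_aemeasurable hG).ennreal_ofReal (μ := P) 1
  simpa using this

theorem tendsto_integral_nearMass (hG : AEMeasurable G P) {x : ℝ}
    (h0 : ∀ᵐ ω ∂P, (G ω).spectralMeasure {x} = 0) :
    Tendsto (fun k => ∫ ω, nearMass x (radius k) (G ω) ∂P) atTop (𝓝 0) := by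
  have := tendsto_integral_of_dominated_convergence (μ := P) (fun _ => (1 : ℝ))
    (F := fun k ω => nearMass x (radius k) (G ω)) (f := fun _ => 0)
    (fun k => (integrable_nearMass hG x (radius_pos k)).1) (integrable_const _)
    (fun k => ae_of_all _ (fun ω => by
      rw [Real.norm_eq_abs, abs_of_nonneg (nearMass_nonneg x _ _)]
      exact nearMass_le_one x _ _))
    (by filter_upwards [h0] with ω hω using tendsto_nearMass hω)
  simpa using this

end RandomFunction

end HPFunction

open HPFunction in
theorem mainTheorem6
    {Ω : ℕ → Type*} [∀ n, MeasurableSpace (Ω n)] {Ω' : Type*} [MeasurableSpace Ω']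
    (P : ∀ n, Measure (Ω n)) [∀ n, IsProbabilityMeasure (P n)]
    (P' : Measure Ω') [IsProbabilityMeasure P']
    (Fn : ∀ n, Ω n → HPFunction) (F : Ω' → HPFunction)
    (hconv : TendstoInDistribution Fn atTop F P P')
    (a b : ℝ)
    (hFn : ∀ n, ∀ᵐ ω ∂(P n), IsSimplePointMeasureOn (Fn n ω).spectralMeasure a b)
    (hF : ∀ᵐ ω ∂P', IsSimplePointMeasureOn (F ω).spectralMeasure a b)
    (x : ℝ) (hx : x ∈ Ioo a b)
    (hE : ∫⁻ ω, (F ω).spectralMeasure {x} ∂P' = 0) :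
    (∀ᵐ ω ∂P', ∃ w : ℂ, (F ω).HasBoundaryValue x w) ∧
    Tendsto (fun n => P n {ω | ¬ ∃ w : ℂ, (Fn n ω).HasBoundaryValue x w}) atTop (𝓝 0) ∧
    TendstoInDistribution (fun n ω => (Fn n ω).boundaryValue x) atTop
      (fun ω => (F ω).boundaryValue x) P P' := by
  have hmn := hconv.forall_aemeasurable
  have hm := hconv.aemeasurable_limit
  have h0 : ∀ᵐ ω ∂P', (F ω).spectralMeasure {x} = 0 :=
    (lintegral_eq_zero_iff'
      ((measurable_spectralMeasure_singleton x).comp_aemeasurable hm)).1 hE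
  have hsmall : ∀ᶠ k in atTop, a ≤ x - radius k ∧ x + radius k ≤ b := by
    have h1 : 0 < min (x - a) (b - x) := lt_min (sub_pos.2 hx.1) (sub_pos.2 hx.2)
    filter_upwards [tendsto_radius.eventually (Iio_mem_nhds h1)] with k hk
    have hk' : radius k < min (x - a) (b - x) := hk
    rw [lt_min_iff] at hk'
    constructor <;> linarith
  have hnear := tendsto_integral_nearMass hm h0
  have hnearn : ∀ k, Tendsto (fun n => ∫ ω, nearMass x (radius k) (Fn n ω) ∂(P n)) atTop
      (𝓝 (∫ ω, nearMass x (radius k) (F ω) ∂P')) := fun k =>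
    hconv.tendsto_integral (BoundedContinuousFunction.ofNormedAddCommGroup (nearMass x (radius k))
      (continuous_nearMass x (radius_pos k)) 1 (fun G => by
        rw [Real.norm_eq_abs, abs_of_nonneg (nearMass_nonneg x _ _)]
        exact nearMass_le_one x _ _))
  refine ⟨?_, ?_, ?_⟩
  · filter_upwards [hF, h0] with ω hω hω0
    obtain ⟨k, ⟨hka, hkb⟩, hk⟩ :=
      (hsmall.and ((tendsto_nearMass hω0).eventually (Iio_mem_nhds one_pos))).exists
    exact ⟨_, exists_hasBoundaryValue_of_nearMass_lt_one hω (radius_pos k) hka hkb hk⟩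
  · rw [ENNReal.tendsto_nhds_zero]
    intro ε hε
    have h1 : Tendsto (fun k => ENNReal.ofReal (∫ ω, nearMass x (radius k) (F ω) ∂P')) atTop
        (𝓝 0) := by
      simpa using ENNReal.tendsto_ofReal hnear
    obtain ⟨k, ⟨hka, hkb⟩, hk⟩ := (hsmall.and (h1.eventually (Iio_mem_nhds hε))).exists
    have h2 := (ENNReal.tendsto_ofReal (hnearn k)).eventually (Iio_mem_nhds hk)
    filter_upwards [h2] with n hn
    exact (measure_not_exists_hasBoundaryValue_le (hmn n) (hFn n) (radius_pos k) hka hkb).trans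
      (le_of_lt hn)
  · have hmbn : ∀ n, AEMeasurable (fun ω => (Fn n ω).boundaryValue x) (P n) :=
      fun n => (measurable_boundaryValue x).comp_aemeasurable (hmn n)
    have hmb : AEMeasurable (fun ω => (F ω).boundaryValue x) P' :=
      (measurable_boundaryValue x).comp_aemeasurable hm
    refine ⟨hmbn, hmb, ?_⟩
    refine ProbabilityMeasure.tendsto_iff_forall_integral_tendsto.2 ?_
    intro f
    have hf : ∀ ν : Measure ℂ, AEStronglyMeasurable f ν :=
      fun ν => f.continuous.measurable.aestronglyMeasurable
    simp only [ProbabilityMeasure.coe_mk]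
    rw [integral_map hmb (hf _)]
    refine Tendsto.congr (fun n => (integral_map (hmbn n) (hf _)).symm) ?_
    rw [Metric.tendsto_nhds]
    intro ε hε
    have h1 : Tendsto (fun k => 2 * ‖f‖ * ∫ ω, nearMass x (radius k) (F ω) ∂P') atTop (𝓝 0) := by
      simpa using hnear.const_mul (2 * ‖f‖)
    obtain ⟨k, ⟨hka, hkb⟩, hk⟩ :=
      (hsmall.and (h1.eventually (Iio_mem_nhds (show 0 < ε / 3 by positivity)))).exists
    have h2 := ((hnearn k).const_mul (2 * ‖f‖)).eventually (Iio_mem_nhds hk)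
    have h3 := Metric.tendsto_nhds.1 (hconv.tendsto_integral
      (f.compContinuous ⟨_, continuous_cutBoundaryValue x (radius_pos k)⟩)) (ε / 3) (by positivity)
    filter_upwards [h2, h3] with n hn2 hn3
    have hn2' : 2 * ‖f‖ * ∫ ω, nearMass x (radius k) (Fn n ω) ∂(P n) < ε / 3 := hn2
    have hk' : 2 * ‖f‖ * ∫ ω, nearMass x (radius k) (F ω) ∂P' < ε / 3 := hk
    have h4 := abs_integral_sub_cutBoundaryValue_le f (hmn n) (hFn n) (radius_pos k) hka hkb
    have h5 := abs_integral_sub_cutBoundaryValue_le f hm hF (radius_pos k) hka hkb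
    simp only [BoundedContinuousFunction.compContinuous_apply, ContinuousMap.coe_mk,
      Real.dist_eq] at hn3
    rw [Real.dist_eq]
    rw [abs_le] at h4 h5
    rw [abs_lt] at hn3 ⊢
    constructor <;> linarith [h4.1, h4.2, h5.1, h5.2, hn3.1, hn3.2]
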